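/- Let $(M_2,g_2)$ be a smooth finite-dimensional Riemannian manifold without boundary, and let $N=\mathbb{R}\times M_2$ carry the Riemannian product metric $g=dt^2+g_2$, with $\partial_t=(1,0)\in T_t\mathbb{R}\oplus T_yM_2=T_{(t,y)}N$. If $M$ is a submanifold of $N$ (smooth, without boundary, embedded or more generally immersed) and $Y$ is a smooth vector field of $N$ along $M$ (a smooth map $Y:M\to TN$ with $Y(x)\in T_xN$), then $M$ is called a *helix submanifold of $N$ with respect to $Y$* if $Y$ is parallel along $M$, that is $\nabla_W Y=0$ for every $W\in TM$, where $\nabla$ is the Levi-Civita connection of $N$, and the function $$h(x)=\max\{\,g(w,Y(x)) : w\in T_xM,\ g(w,w)=1\,\},\qquad x\in M,$$ is constant (if $\dim M=0$, we set $h=0$). **Proposition.** Let $M$ be a compact helix submanifold of the Riemannian product $N=\mathbb{R}\times M_2$ with respect to $X=\partial_t$ (restricted to $M$). Then $X$ is orthogonal to $M$, i.e. $g(X(x),w)=0$ for every $x\in M$ and every $w\in T_xM$. -/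

import Mathlib

open Bundle Manifold ContDiff Topology

noncomputable section

/-! ### Pullback of bilinear forms and the Riemannian product metric -/

section Product

variable {E E' H H' N N' : Type*}
  [NormedAddCommGroup E] [NormedSpace ℝ E] [NormedAddCommGroup E'] [NormedSpace ℝ E']
  [TopologicalSpace H] [TopologicalSpace H']
  {I : ModelWithCorners ℝ E H} {I' : ModelWithCorners ℝ E' H'}
  [TopologicalSpace N] [ChartedSpace H N] [TopologicalSpace N'] [ChartedSpace H' N']

/-- The pullback `(v, w) ↦ b (df v) (df w)` under `f` of a bilinear form `b` on `T_{f p} N'`. -/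
def pullbackForm (I : ModelWithCorners ℝ E H) (I' : ModelWithCorners ℝ E' H') (f : N → N') (p : N)
    (b : TangentSpace I' (f p) →L[ℝ] TangentSpace I' (f p) →L[ℝ] ℝ) :
    TangentSpace I p →L[ℝ] TangentSpace I p →L[ℝ] ℝ :=
  (ContinuousLinearMap.precomp ℝ (mfderiv I I' f p)) ∘L b ∘L mfderiv I I' f p

lemma pullbackForm_apply (f : N → N') (p : N)
    (b : TangentSpace I' (f p) →L[ℝ] TangentSpace I' (f p) →L[ℝ] ℝ) (v w : TangentSpace I p) :
    pullbackForm I I' f p b v w = b (mfderiv I I' f p v) (mfderiv I I' f p w) := rfl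

lemma linearMapAt_trivial {B : Type*} [TopologicalSpace B] (b₀ b : B) (r : ℝ) :
    (trivializationAt ℝ (Trivial B ℝ) b₀).linearMapAt ℝ b r = r := by
  simp

lemma contMDiff_pullbackForm [IsManifold I ∞ N] [IsManifold I' ∞ N'] {f : N → N'}
    (hf : ContMDiff I I' ∞ f)
    {g : (y : N') → TangentSpace I' y →L[ℝ] TangentSpace I' y →L[ℝ] ℝ}
    (hg : ContMDiff I' (I'.prod 𝓘(ℝ, E' →L[ℝ] E' →L[ℝ] ℝ)) ∞
      (fun y ↦ TotalSpace.mk' (E' →L[ℝ] E' →L[ℝ] ℝ)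
        (E := fun y : N' ↦ TangentSpace I' y →L[ℝ] TangentSpace I' y →L[ℝ] ℝ) y (g y))) :
    ContMDiff I (I.prod 𝓘(ℝ, E →L[ℝ] E →L[ℝ] ℝ)) ∞
      (fun x ↦ TotalSpace.mk' (E →L[ℝ] E →L[ℝ] ℝ)
        (E := fun x : N ↦ TangentSpace I x →L[ℝ] TangentSpace I x →L[ℝ] ℝ) x
        (pullbackForm I I' f x (g (f x)))) := by
  intro x₀
  have h1 := ((contMDiffAt_hom_bundle _).1 (hg (f x₀))).2
  have h2 := h1.comp x₀ (hf x₀)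
  have h3 : ContMDiffAt I 𝓘(ℝ, E →L[ℝ] E') ∞
      (inTangentCoordinates I I' id f (mfderiv I I' f) x₀) x₀ :=
    ContMDiffAt.mfderiv_const (hf x₀) (by rfl)
  refine (contMDiffAt_hom_bundle _).2 ⟨contMDiffAt_id, ?_⟩
  have h4 := (h3.clm_precomp (F₃ := ℝ)).clm_comp (h2.clm_comp h3)
  refine h4.congr_of_eventuallyEq ?_
  have hs : ∀ᶠ x in 𝓝 x₀, x ∈ (chartAt H x₀).source :=
    (chartAt H x₀).open_source.mem_nhds (mem_chart_source H x₀)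
  have hs' : ∀ᶠ x in 𝓝 x₀, f x ∈ (chartAt H' (f x₀)).source :=
    hf.continuous.continuousAt.preimage_mem_nhds
      ((chartAt H' (f x₀)).open_source.mem_nhds (mem_chart_source H' (f x₀)))
  filter_upwards [hs, hs'] with x hx hx'
  ext v w
  have key (u : TangentSpace I' (f x)) :
      (trivializationAt E' (TangentSpace I') (f x₀)).symm (f x)
        ((trivializationAt E' (TangentSpace I') (f x₀)).continuousLinearMapAt ℝ (f x) u) = u :=
    ((trivializationAt E' (TangentSpace I') (f x₀)).symmL_apply (R := ℝ) (b := f x) hx' _).symm.trans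
      ((trivializationAt E' (TangentSpace I') (f x₀)).symmL_continuousLinearMapAt (R := ℝ) hx' u)
  change _ = ContinuousLinearMap.inCoordinates E' (TangentSpace I') (E' →L[ℝ] ℝ)
    (fun b => TangentSpace I' b →L[ℝ] Trivial N' ℝ b) (f x₀) (f x) (f x₀) (f x) (g (f x))
      ((trivializationAt E' (TangentSpace I') (f x₀)).continuousLinearMapAt ℝ (f x)
        (mfderiv I I' f x ((trivializationAt E (TangentSpace I) x₀).symmL ℝ x v)))
      ((trivializationAt E' (TangentSpace I') (f x₀)).continuousLinearMapAt ℝ (f x)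
        (mfderiv I I' f x ((trivializationAt E (TangentSpace I) x₀).symmL ℝ x w)))
  refine (inCoordinates_apply_eq₂ (E₃ := Trivial N ℝ) hx hx (Set.mem_univ _)).trans
    (Eq.symm ((inCoordinates_apply_eq₂ (E₃ := Trivial N' ℝ) hx' hx' (Set.mem_univ _)).trans ?_))
  erw [key, key]
  refine (linearMapAt_trivial (f x₀) (f x) _).trans (Eq.trans ?_ (linearMapAt_trivial x₀ x _).symm)
  rw [pullbackForm_apply]
  have hs (u : E) := (trivializationAt E (TangentSpace I) x₀).symmL_apply (R := ℝ) (b := x) hx u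
  rw [hs v, hs w]

/-- The Riemannian product metric on `N × N'`:
`⟨v, w⟩ = ⟨dπ₁ v, dπ₁ w⟩ + ⟨dπ₂ v, dπ₂ w⟩`, where `π₁`, `π₂` are the two projections. -/
def productMetric [IsManifold I ∞ N] [IsManifold I' ∞ N']
    (g : ContMDiffRiemannianMetric I ∞ E (fun x : N ↦ TangentSpace I x))
    (g' : ContMDiffRiemannianMetric I' ∞ E' (fun x : N' ↦ TangentSpace I' x)) :
    ContMDiffRiemannianMetric (I.prod I') ∞ (E × E')
      (fun p : N × N' ↦ TangentSpace (I.prod I') p) where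
  inner p := pullbackForm (I.prod I') I Prod.fst p (g.inner p.1) +
    pullbackForm (I.prod I') I' Prod.snd p (g'.inner p.2)
  symm p v w := congrArg₂ (· + ·) (g.symm p.1 _ _) (g'.symm p.2 _ _)
  pos p v hv := by
    change 0 < g.inner p.1 (mfderiv (I.prod I') I Prod.fst p v)
        (mfderiv (I.prod I') I Prod.fst p v) +
      g'.inner p.2 (mfderiv (I.prod I') I' Prod.snd p v) (mfderiv (I.prod I') I' Prod.snd p v)
    rw [mfderiv_fst, mfderiv_snd]
    have h0 (a : TangentSpace I p.1) : 0 ≤ g.inner p.1 a a := by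
      by_cases h : a = 0
      · simp [h]
      · exact (g.pos _ _ h).le
    have h0' (a : TangentSpace I' p.2) : 0 ≤ g'.inner p.2 a a := by
      by_cases h : a = 0
      · simp [h]
      · exact (g'.pos _ _ h).le
    by_cases h : (show E × E' from v).1 = 0
    · have h' : (show E × E' from v).2 ≠ 0 := fun h' ↦ hv (Prod.ext h h')
      exact add_pos_of_nonneg_of_pos (h0 _) (g'.pos p.2 _ h')
    · exact add_pos_of_pos_of_nonneg (g.pos p.1 _ h) (h0' _)
  isVonNBounded p := by
    have h0 (a : TangentSpace I p.1) : 0 ≤ g.inner p.1 a a := by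
      by_cases h : a = 0
      · simp [h]
      · exact (g.pos _ _ h).le
    have h0' (a : TangentSpace I' p.2) : 0 ≤ g'.inner p.2 a a := by
      by_cases h : a = 0
      · simp [h]
      · exact (g'.pos _ _ h).le
    have hb : Bornology.IsBounded {a : E | g.inner p.1 a a < 1} :=
      (NormedSpace.isVonNBounded_iff ℝ).1 (g.isVonNBounded p.1)
    have hb' : Bornology.IsBounded {a : E' | g'.inner p.2 a a < 1} :=
      (NormedSpace.isVonNBounded_iff ℝ).1 (g'.isVonNBounded p.2)
    refine (NormedSpace.isVonNBounded_iff (E := E × E') ℝ).2 ((hb.prod hb').subset ?_)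
    intro v hv
    change g.inner p.1 (mfderiv (I.prod I') I Prod.fst p v)
        (mfderiv (I.prod I') I Prod.fst p v) +
      g'.inner p.2 (mfderiv (I.prod I') I' Prod.snd p v)
        (mfderiv (I.prod I') I' Prod.snd p v) < 1 at hv
    rw [mfderiv_fst, mfderiv_snd] at hv
    exact ⟨lt_of_le_of_lt (le_add_of_nonneg_right (h0' _)) hv,
      lt_of_le_of_lt (le_add_of_nonneg_left (h0 _)) hv⟩
  contMDiff := by
    intro p₀
    have h := ((contMDiffAt_hom_bundle _).1
      (contMDiff_pullbackForm (I := I.prod I') contMDiff_fst g.contMDiff p₀)).2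
    have h' := ((contMDiffAt_hom_bundle _).1
      (contMDiff_pullbackForm (I := I.prod I') contMDiff_snd g'.contMDiff p₀)).2
    refine (contMDiffAt_hom_bundle _).2 ⟨contMDiffAt_id, (h.add h').congr_of_eventuallyEq ?_⟩
    filter_upwards with p
    simp [ContinuousLinearMap.inCoordinates]

/-- The standard metric `dt²` of the real line. -/
def realLineMetric :
    ContMDiffRiemannianMetric 𝓘(ℝ, ℝ) ∞ ℝ (fun t : ℝ ↦ TangentSpace 𝓘(ℝ, ℝ) t) where
  __ := riemannianMetricVectorSpace ℝ
  contMDiff := (riemannianMetricVectorSpace ℝ).contMDiff.of_le le_top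

/-- The vector field `∂_t = (1, 0) ∈ T_t ℝ ⊕ T_y N = T_{(t, y)} (ℝ × N)` on `ℝ × N`. -/
def coordinateFieldT (I : ModelWithCorners ℝ E H) (p : ℝ × N) :
    TangentSpace (𝓘(ℝ, ℝ).prod I) p :=
  ((1, 0) : ℝ × E)

end Product

/-! ### Vector fields along a map into a Riemannian manifold -/

section Helix

variable {E F H G M N : Type*}
  [NormedAddCommGroup E] [NormedSpace ℝ E] [NormedAddCommGroup F] [NormedSpace ℝ F]
  [TopologicalSpace H] [TopologicalSpace G]
  {I : ModelWithCorners ℝ E H} {J : ModelWithCorners ℝ F G}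
  [TopologicalSpace M] [ChartedSpace H M]
  [TopologicalSpace N] [ChartedSpace G N] [IsManifold J ∞ N]

/-- The coefficients of the metric in the preferred chart `φ` at `p`: at the point `u` of the
model space, the form `(v, w) ↦ g (dφ⁻¹ v) (dφ⁻¹ w)` at `φ⁻¹ u`. -/
def metricInChart (g : ContMDiffRiemannianMetric J ∞ F (fun x : N ↦ TangentSpace J x))
    (p : N) (u v w : F) : ℝ :=
  g.inner ((extChartAt J p).symm u)
    ((trivializationAt F (TangentSpace J) p).symmL ℝ ((extChartAt J p).symm u) v)
    ((trivializationAt F (TangentSpace J) p).symmL ℝ ((extChartAt J p).symm u) w)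

/-- The Christoffel symbols of the first kind of the Levi-Civita connection of `g` at `p`, in the
preferred chart at `p` (for `N` without boundary):
`⟨Γ(a, b), c⟩ = (∂_a g(b, c) + ∂_b g(a, c) - ∂_c g(a, b)) / 2`. -/
def christoffelFirstKind
    (g : ContMDiffRiemannianMetric J ∞ F (fun x : N ↦ TangentSpace J x))
    (p : N) (a b c : F) : ℝ :=
  (fderiv ℝ (fun u ↦ metricInChart g p u b c) (extChartAt J p p) a +
    fderiv ℝ (fun u ↦ metricInChart g p u a c) (extChartAt J p p) b -
    fderiv ℝ (fun u ↦ metricInChart g p u a b) (extChartAt J p p) c) / 2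

/-- The components, near `x`, of a vector field `Y` along `ι : M → N` in the preferred chart of `N`
at `ι x`. -/
def componentsAlong (J : ModelWithCorners ℝ F G) [IsManifold J ∞ N] (ι : M → N)
    (Y : (x : M) → TangentSpace J (ι x)) (x : M) : M → F := fun z ↦
  (trivializationAt F (TangentSpace J) (ι x)).continuousLinearMapAt ℝ (ι z) (Y z)

/-- The inner product `g (∇_W Y) Z`, where `∇_W Y = W(Y) + Γ(dι W, Y)` is the covariant derivative
at `x` of the vector field `Y` along `ι`, induced by the Levi-Civita connection of `g`, and `Z` is
given by its components in the preferred chart of `N` at `ι x`. -/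
def covariantDerivInner (I : ModelWithCorners ℝ E H)
    (g : ContMDiffRiemannianMetric J ∞ F (fun x : N ↦ TangentSpace J x))
    (ι : M → N) (Y : (x : M) → TangentSpace J (ι x)) (x : M) (W : TangentSpace I x) (Z : F) : ℝ :=
  metricInChart g (ι x) (extChartAt J (ι x) (ι x))
      (mfderiv I 𝓘(ℝ, F) (componentsAlong J ι Y x) x W) Z +
    christoffelFirstKind g (ι x)
      ((trivializationAt F (TangentSpace J) (ι x)).continuousLinearMapAt ℝ (ι x)
        (mfderiv I J ι x W))
      (componentsAlong J ι Y x x) Z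

/-- `Y` is parallel along `ι : M → N`: `∇_W Y = 0` for every tangent vector `W` of `M`. -/
def IsParallelAlong (I : ModelWithCorners ℝ E H)
    (g : ContMDiffRiemannianMetric J ∞ F (fun x : N ↦ TangentSpace J x))
    (ι : M → N) (Y : (x : M) → TangentSpace J (ι x)) : Prop :=
  ∀ (x : M) (W : TangentSpace I x) (Z : F), covariantDerivInner I g ι Y x W Z = 0

/-- The function `h(x) = max {g(w, Y x) | w ∈ T_x M, g(w, w) = 1}`, for `M` immersed in `N` by `ι`
with the induced metric. If `0 < dim M < ∞` the supremum is a maximum; if `dim M = 0`, there are no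
unit vectors and the value is `0`, the length of the tangential part of `Y x`. -/
def angleFunction (I : ModelWithCorners ℝ E H)
    (g : ContMDiffRiemannianMetric J ∞ F (fun x : N ↦ TangentSpace J x))
    (ι : M → N) (Y : (x : M) → TangentSpace J (ι x)) (x : M) : ℝ :=
  sSup {r : ℝ | ∃ w : TangentSpace I x,
    g.inner (ι x) (mfderiv I J ι x w) (mfderiv I J ι x w) = 1 ∧
    g.inner (ι x) (mfderiv I J ι x w) (Y x) = r}

/-- `M`, immersed by `ι`, is a helix submanifold of `(N, g)` with respect to `Y`: the field `Y` is
a smooth vector field of `N` along `M`, it is parallel along `M`, and the function `h` is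
constant. -/
structure IsHelix (I : ModelWithCorners ℝ E H)
    (g : ContMDiffRiemannianMetric J ∞ F (fun x : N ↦ TangentSpace J x))
    (ι : M → N) (Y : (x : M) → TangentSpace J (ι x)) : Prop where
  isImmersion : IsImmersion I J ∞ ι
  contMDiff : ContMDiff I J.tangent ∞ (fun x ↦ (⟨ι x, Y x⟩ : TangentBundle J N))
  isParallelAlong : IsParallelAlong I g ι Y
  constant : ∃ c : ℝ, ∀ x, angleFunction I g ι Y x = c

/-- `Y` is orthogonal to `M`, immersed in `N` by `ι`. -/
def IsOrthogonalTo (I : ModelWithCorners ℝ E H)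
    (g : ContMDiffRiemannianMetric J ∞ F (fun x : N ↦ TangentSpace J x))
    (ι : M → N) (Y : (x : M) → TangentSpace J (ι x)) : Prop :=
  ∀ (x : M) (w : TangentSpace I x), g.inner (ι x) (Y x) (mfderiv I J ι x w) = 0

end Helix

end

/-! The field `∂_t` is the gradient of the coordinate `t`, so `g(dι w, ∂_t)` is the derivative along
`w` of the height function `t ∘ ι`, and `h` measures the size of that derivative on unit vectors. On
compact `M` the height has a maximum `x₀`; its derivative vanishes there, so `h(x₀) = 0`
(`angleFunction_eq_zero_of_isLocalMax`). Since `h` is constant, it is zero everywhere. By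
homogeneity `g(dι w, ∂_t) ≤ h · |dι w|` (`fst_mfderiv_le_angleFunction_mul_sqrt`), so the pairing is
at most zero for both `w` and `-w`, hence zero. -/

/-- The derivative of a real function on a boundaryless manifold vanishes at a local maximum. -/
theorem IsLocalMax.mfderiv_eq_zero {E M : Type*} [NormedAddCommGroup E] [NormedSpace ℝ E]
    [TopologicalSpace M] [ChartedSpace E M] {f : M → ℝ} {x : M} (h : IsLocalMax f x) :
    mfderiv 𝓘(ℝ, E) 𝓘(ℝ, ℝ) f x = 0 := by
  by_cases hf : MDifferentiableAt 𝓘(ℝ, E) 𝓘(ℝ, ℝ) f x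
  · rw [hf.mfderiv]
    simp only [modelWithCornersSelf_coe, Set.range_id, fderivWithin_univ]
    refine IsLocalMax.fderiv_eq_zero ?_
    -- The inverse chart is continuous at the image of `x`, so the local maximum carries over to the
    -- function read in the chart.
    have hc : Filter.Tendsto (extChartAt 𝓘(ℝ, E) x).symm (𝓝 (extChartAt 𝓘(ℝ, E) x x)) (𝓝 x) := by
      simpa using! (continuousAt_extChartAt_symm (I := 𝓘(ℝ, E)) x).tendsto
    filter_upwards [hc.eventually h] with u hu
    simpa only [writtenInExtChartAt, extChartAt_model_space_eq_id, PartialEquiv.refl_coe,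
      Function.comp_apply, id, extChartAt_to_inv] using hu
  -- Without differentiability, `mfderiv` is zero by convention.
  · exact mfderiv_zero_of_not_mdifferentiableAt hf

section ProductWithLine

variable {E₂ M₂ : Type*} [NormedAddCommGroup E₂] [NormedSpace ℝ E₂]
  [TopologicalSpace M₂] [ChartedSpace E₂ M₂] [IsManifold 𝓘(ℝ, E₂) ∞ M₂]
  (g₂ : ContMDiffRiemannianMetric 𝓘(ℝ, E₂) ∞ E₂ (fun y : M₂ ↦ TangentSpace 𝓘(ℝ, E₂) y))

theorem productMetric_realLineMetric_inner (p : ℝ × M₂)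
    (v w : TangentSpace (𝓘(ℝ, ℝ).prod 𝓘(ℝ, E₂)) p) :
    (productMetric realLineMetric g₂).inner p v w =
      (show ℝ × E₂ from v).1 * (show ℝ × E₂ from w).1 +
        g₂.inner p.2 (show ℝ × E₂ from v).2 (show ℝ × E₂ from w).2 := by
  change inner ℝ
      (show ℝ from mfderiv (𝓘(ℝ, ℝ).prod 𝓘(ℝ, E₂)) 𝓘(ℝ, ℝ) Prod.fst p v)
      (show ℝ from mfderiv (𝓘(ℝ, ℝ).prod 𝓘(ℝ, E₂)) 𝓘(ℝ, ℝ) Prod.fst p w) +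
    g₂.inner p.2 (mfderiv (𝓘(ℝ, ℝ).prod 𝓘(ℝ, E₂)) 𝓘(ℝ, E₂) Prod.snd p v)
      (mfderiv (𝓘(ℝ, ℝ).prod 𝓘(ℝ, E₂)) 𝓘(ℝ, E₂) Prod.snd p w) = _
  rw [mfderiv_fst, mfderiv_snd]
  refine congrArg₂ (· + ·) ?_ rfl
  exact mul_comm _ _

theorem productMetric_inner_coordinateFieldT (p : ℝ × M₂)
    (v : TangentSpace (𝓘(ℝ, ℝ).prod 𝓘(ℝ, E₂)) p) :
    (productMetric realLineMetric g₂).inner p v (coordinateFieldT 𝓘(ℝ, E₂) p) =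
      (show ℝ × E₂ from v).1 := by
  rw [productMetric_realLineMetric_inner]
  have h : g₂.inner p.2 (show ℝ × E₂ from v).2 (0 : E₂) = 0 := map_zero _
  change (show ℝ × E₂ from v).1 * 1 + g₂.inner p.2 (show ℝ × E₂ from v).2 (0 : E₂) = _
  rw [h, mul_one, add_zero]

/-- Cauchy–Schwarz against the unit field `∂_t`: the `M₂` part of the metric only adds a nonnegative
term. -/
theorem sq_fst_le_productMetric_inner_self (p : ℝ × M₂)
    (v : TangentSpace (𝓘(ℝ, ℝ).prod 𝓘(ℝ, E₂)) p) :
    (show ℝ × E₂ from v).1 ^ 2 ≤ (productMetric realLineMetric g₂).inner p v v := by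
  rw [productMetric_realLineMetric_inner, sq]
  refine le_add_of_nonneg_right ?_
  by_cases h : (show ℝ × E₂ from v).2 = 0
  · rw [h]
    exact (map_zero (g₂.inner p.2 (0 : E₂))).ge
  · exact (g₂.pos p.2 _ h).le

variable {E M : Type*} [NormedAddCommGroup E] [NormedSpace ℝ E]
  [TopologicalSpace M] [ChartedSpace E M] {ι : M → ℝ × M₂}

omit [IsManifold 𝓘(ℝ, E₂) ∞ M₂] in
/-- The first component of `dι` is the derivative of the height function `x ↦ (ι x).1`. -/
theorem fst_mfderiv_eq_mfderiv_fst_comp {x : M}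
    (hι : MDifferentiableAt 𝓘(ℝ, E) (𝓘(ℝ, ℝ).prod 𝓘(ℝ, E₂)) ι x) (w : TangentSpace 𝓘(ℝ, E) x) :
    (show ℝ × E₂ from mfderiv 𝓘(ℝ, E) (𝓘(ℝ, ℝ).prod 𝓘(ℝ, E₂)) ι x w).1 =
      mfderiv 𝓘(ℝ, E) 𝓘(ℝ, ℝ) (fun z ↦ (ι z).1) x w := by
  have h := mfderiv_comp_apply (I := 𝓘(ℝ, E)) (I' := 𝓘(ℝ, ℝ).prod 𝓘(ℝ, E₂)) (I'' := 𝓘(ℝ, ℝ))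
    (g := Prod.fst) (f := ι) x mdifferentiableAt_fst hι w
  rw [mfderiv_fst] at h
  exact h.symm

/-- The angle function of `∂_t` vanishes where the height function has a local maximum. -/
theorem angleFunction_eq_zero_of_isLocalMax {x : M}
    (hι : MDifferentiableAt 𝓘(ℝ, E) (𝓘(ℝ, ℝ).prod 𝓘(ℝ, E₂)) ι x)
    (hx : IsLocalMax (fun z ↦ (ι z).1) x) :
    angleFunction 𝓘(ℝ, E) (productMetric realLineMetric g₂) ι
      (fun x ↦ coordinateFieldT 𝓘(ℝ, E₂) (ι x)) x = 0 := by
  have hsub : ∀ r ∈ {r : ℝ | ∃ w : TangentSpace 𝓘(ℝ, E) x,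
      (productMetric realLineMetric g₂).inner (ι x)
        (mfderiv 𝓘(ℝ, E) (𝓘(ℝ, ℝ).prod 𝓘(ℝ, E₂)) ι x w)
        (mfderiv 𝓘(ℝ, E) (𝓘(ℝ, ℝ).prod 𝓘(ℝ, E₂)) ι x w) = 1 ∧
      (productMetric realLineMetric g₂).inner (ι x)
        (mfderiv 𝓘(ℝ, E) (𝓘(ℝ, ℝ).prod 𝓘(ℝ, E₂)) ι x w)
        (coordinateFieldT 𝓘(ℝ, E₂) (ι x)) = r}, r = 0 := by
    rintro r ⟨w, -, rfl⟩
    rw [productMetric_inner_coordinateFieldT, fst_mfderiv_eq_mfderiv_fst_comp hι,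
      hx.mfderiv_eq_zero]
    rfl
  -- Both bounds also hold for the empty set, whose `sSup` is `0`; this covers `dim M = 0`.
  exact le_antisymm (Real.sSup_nonpos fun r hr ↦ (hsub r hr).le)
    (Real.sSup_nonneg fun r hr ↦ (hsub r hr).ge)

/-- The component of `dι w` along `∂_t` is at most `h` times the length of `dι w`. -/
theorem fst_mfderiv_le_angleFunction_mul_sqrt (x : M) (w : TangentSpace 𝓘(ℝ, E) x) :
    (show ℝ × E₂ from mfderiv 𝓘(ℝ, E) (𝓘(ℝ, ℝ).prod 𝓘(ℝ, E₂)) ι x w).1 ≤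
      angleFunction 𝓘(ℝ, E) (productMetric realLineMetric g₂) ι
        (fun x ↦ coordinateFieldT 𝓘(ℝ, E₂) (ι x)) x *
      √((productMetric realLineMetric g₂).inner (ι x)
        (mfderiv 𝓘(ℝ, E) (𝓘(ℝ, ℝ).prod 𝓘(ℝ, E₂)) ι x w)
        (mfderiv 𝓘(ℝ, E) (𝓘(ℝ, ℝ).prod 𝓘(ℝ, E₂)) ι x w)) := by
  set D := mfderiv 𝓘(ℝ, E) (𝓘(ℝ, ℝ).prod 𝓘(ℝ, E₂)) ι x with hD
  set G := (productMetric realLineMetric g₂).inner (ι x) with hG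
  have hle := sq_fst_le_productMetric_inner_self g₂ (ι x) (D w)
  have hX := productMetric_inner_coordinateFieldT g₂ (ι x) (D w)
  rw [← hG] at hle hX
  rw [← hX] at hle ⊢
  -- If `dι w` has length zero, its `∂_t` component vanishes by `hle`; otherwise `w` can be
  -- normalised.
  rcases (le_trans (sq_nonneg _) hle).eq_or_lt with h0 | hpos
  · rw [← h0] at hle ⊢
    rw [Real.sqrt_zero, mul_zero]
    exact (pow_eq_zero_iff two_ne_zero |>.1 (le_antisymm hle (sq_nonneg _))).le
  · have hs : 0 < √(G (D w) (D w)) := Real.sqrt_pos.2 hpos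
    rw [← div_le_iff₀ hs]
    -- The upper bound `1` is Cauchy–Schwarz for unit vectors, as `∂_t` has length one; the
    -- competitor in the supremum is `w` divided by the length of `dι w`.
    refine le_csSup ⟨1, ?_⟩ ⟨(√(G (D w) (D w)))⁻¹ • w, ?_, ?_⟩
    · rintro r ⟨v, hv, rfl⟩
      have h := sq_fst_le_productMetric_inner_self g₂ (ι x) (D v)
      rw [← productMetric_inner_coordinateFieldT g₂ (ι x) (D v)] at h
      exact (abs_le_one_iff_mul_self_le_one.2 (by rw [← sq]; exact h.trans hv.le)
        |> le_trans (le_abs_self _))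
    · rw [← hD, ← hG]
      simp only [map_smul, smul_apply, smul_eq_mul]
      rw [← mul_assoc, ← mul_inv, Real.mul_self_sqrt hpos.le, inv_mul_cancel₀ hpos.ne']
    · rw [← hD, ← hG]
      simp only [map_smul, smul_apply, smul_eq_mul]
      rw [div_eq_inv_mul]

end ProductWithLine

theorem mainTheorem12
    {E E₂ M M₂ : Type*}
    [NormedAddCommGroup E] [NormedSpace ℝ E] [FiniteDimensional ℝ E]
    [NormedAddCommGroup E₂] [NormedSpace ℝ E₂] [FiniteDimensional ℝ E₂]
    [TopologicalSpace M] [ChartedSpace E M] [IsManifold 𝓘(ℝ, E) ∞ M] [CompactSpace M]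
    [TopologicalSpace M₂] [ChartedSpace E₂ M₂] [IsManifold 𝓘(ℝ, E₂) ∞ M₂]
    (g₂ : ContMDiffRiemannianMetric 𝓘(ℝ, E₂) ∞ E₂ (fun y : M₂ ↦ TangentSpace 𝓘(ℝ, E₂) y))
    (ι : M → ℝ × M₂)
    (hM : IsHelix 𝓘(ℝ, E) (productMetric realLineMetric g₂) ι
      (fun x ↦ coordinateFieldT 𝓘(ℝ, E₂) (ι x))) :
    IsOrthogonalTo 𝓘(ℝ, E) (productMetric realLineMetric g₂) ι
      (fun x ↦ coordinateFieldT 𝓘(ℝ, E₂) (ι x)) := by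
  intro x w
  have hι : ContMDiff 𝓘(ℝ, E) (𝓘(ℝ, ℝ).prod 𝓘(ℝ, E₂)) ∞ ι := hM.isImmersion.contMDiff
  obtain ⟨c, hc⟩ := hM.constant
  obtain ⟨x₀, -, hx₀⟩ := isCompact_univ.exists_isMaxOn ⟨x, Set.mem_univ x⟩
    (continuous_fst.comp hι.continuous).continuousOn
  have hmax : IsLocalMax (fun z ↦ (ι z).1) x₀ :=
    Filter.Eventually.of_forall fun z ↦ hx₀ (Set.mem_univ z)
  have hx : angleFunction 𝓘(ℝ, E) (productMetric realLineMetric g₂) ι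
      (fun x ↦ coordinateFieldT 𝓘(ℝ, E₂) (ι x)) x = 0 := by
    rw [hc x, ← hc x₀]
    exact angleFunction_eq_zero_of_isLocalMax g₂ (hι.mdifferentiable (by simp) x₀) hmax
  have hle := fst_mfderiv_le_angleFunction_mul_sqrt (ι := ι) g₂ x w
  -- The estimate is one-sided; applying it to `-w` gives the reverse inequality.
  have hge := fst_mfderiv_le_angleFunction_mul_sqrt (ι := ι) g₂ x (-w)
  rw [hx, zero_mul, ← productMetric_inner_coordinateFieldT g₂] at hle hge
  rw [map_neg, map_neg, neg_apply, neg_nonpos] at hge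
  rw [(productMetric realLineMetric g₂).symm]
  exact le_antisymm hle hge
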